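/- Let $d,k\ge 0$ be integers, let $A^*\in\mathbb{R}^{d\times d}$ be an arbitrary matrix, and let $U_1^*,U_2^*\in\mathbb{R}^{d\times k}$ be such that the $2k$ columns of $U_1^*$ and $U_2^*$ together form a linearly independent family. For $A\in\mathbb{R}^{d\times d}$ and $U=(U_1,U_2)\in(\mathbb{R}^{d\times k})^2$ let $$\mathcal{L}(A,U)=\frac12\sum_{t=1}^{2}\left\|A^*+U_t^*U_t^{*\top}-A-U_tU_t^{\top}\right\|_F^2$$ be the infinite-sample Meta-LoRA loss for $T=2$ retraining tasks. Regard $\mathcal{L}$ as a function of the flattened vector $[\mathrm{vec}(A);\mathrm{vec}(U_1);\mathrm{vec}(U_2)]\in\mathbb{R}^{d^2+2dk}$ with the Euclidean inner product, and call a point a second-order stationary point (SOSP) of $\mathcal{L}$ if $\nabla\mathcal{L}=0$ and $\nabla^2\mathcal{L}\succeq 0$ there. Then for every $\hat A\in\mathbb{R}^{d\times d}$ and $\hat U\in(\mathbb{R}^{d\times k})^2$: 1. $\mathcal{L}(\hat A,\hat U)=0$ if and only if $(\hat A,\hat U)$ is an SOSP of $\mathcal{L}$; 2. $(\hat A,\hat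 U)$ is a global minimizer of $\mathcal{L}$ if and only if it is an SOSP of $\mathcal{L}$; 3. if $\nabla\mathcal{L}(\hat A,\hat U)=0$ and $\mathcal{L}(\hat A,\hat U)\ne 0$, then $\nabla^2\mathcal{L}(\hat A,\hat U)$ has a negative eigenvalue. -/

import Mathlib

namespace MetaLoRA

open scoped Matrix.Norms.Frobenius Matrix in
/-- The infinite-sample Meta-LoRA loss with symmetric adapters for `T` retraining tasks,
`L(A, U) = (1/2) ∑ t, ‖A⋆ + U⋆ₜ U⋆ₜᵀ - A - Uₜ Uₜᵀ‖²` (Frobenius norm). -/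
noncomputable def loss {T d k : ℕ} (Astar : Matrix (Fin d) (Fin d) ℝ)
    (Ustar : Fin T → Matrix (Fin d) (Fin k) ℝ)
    (A : Matrix (Fin d) (Fin d) ℝ) (U : Fin T → Matrix (Fin d) (Fin k) ℝ) : ℝ :=
  (1 / 2) * ∑ t, ‖Astar + Ustar t * (Ustar t)ᵀ - A - U t * (U t)ᵀ‖ ^ 2

/-- The Euclidean space of flattened parameters `[vec A; vec U₁; …; vec U_T]`. -/
abbrev Param (T d k : ℕ) : Type :=
  EuclideanSpace ℝ ((Fin d × Fin d) ⊕ (Fin T × Fin d × Fin k))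

/-- Flattening of the matrices `(A, U₁, …, U_T)` into one vector. -/
def flatten {T d k : ℕ} (A : Matrix (Fin d) (Fin d) ℝ)
    (U : Fin T → Matrix (Fin d) (Fin k) ℝ) : Param T d k :=
  WithLp.toLp 2 (Sum.elim (fun p => A p.1 p.2) (fun p => U p.1 p.2.1 p.2.2))

/-- The matrix `A` of a flattened parameter vector. -/
def partA {T d k : ℕ} (x : Param T d k) : Matrix (Fin d) (Fin d) ℝ :=
  Matrix.of fun i j => x (Sum.inl (i, j))

/-- The matrices `U₁, …, U_T` of a flattened parameter vector. -/
def partU {T d k : ℕ} (x : Param T d k) : Fin T → Matrix (Fin d) (Fin k) ℝ :=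
  fun t => Matrix.of fun i a => x (Sum.inr (t, i, a))

@[simp] theorem partA_flatten {T d k : ℕ} (A : Matrix (Fin d) (Fin d) ℝ)
    (U : Fin T → Matrix (Fin d) (Fin k) ℝ) : partA (flatten A U) = A := rfl

@[simp] theorem partU_flatten {T d k : ℕ} (A : Matrix (Fin d) (Fin d) ℝ)
    (U : Fin T → Matrix (Fin d) (Fin k) ℝ) : partU (flatten A U) = U := rfl

@[simp] theorem flatten_parts {T d k : ℕ} (x : Param T d k) :
    flatten (partA x) (partU x) = x := by
  ext i
  rcases i with i | i <;> rfl

/-- The loss as a function of the flattened parameter vector. -/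
noncomputable def flatLoss {T d k : ℕ} (Astar : Matrix (Fin d) (Fin d) ℝ)
    (Ustar : Fin T → Matrix (Fin d) (Fin k) ℝ) (x : Param T d k) : ℝ :=
  loss Astar Ustar (partA x) (partU x)

/-- The Hessian of `f` at `x`, as an operator: the derivative of the gradient. -/
noncomputable def hessian {E : Type*} [NormedAddCommGroup E] [InnerProductSpace ℝ E]
    [CompleteSpace E] (f : E → ℝ) (x : E) : E →L[ℝ] E :=
  fderiv ℝ (gradient f) x

/-- Second-order stationary points (for twice continuously differentiable `f`):
the gradient vanishes and the Hessian is positive semidefinite. -/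
def IsSOSP {E : Type*} [NormedAddCommGroup E] [InnerProductSpace ℝ E]
    [CompleteSpace E] (f : E → ℝ) (x : E) : Prop :=
  gradient f x = 0 ∧ (hessian f x).IsPositive

end MetaLoRA

/-! Let `S` be the residual of the first task at a critical point, `U₁, U₂` its adapters, `W₁, W₂`
the true ones. Stationarity in `A` makes the second residual `-S`, so `2S = W₁W₁ᵀ - U₁U₁ᵀ - W₂W₂ᵀ +
U₂U₂ᵀ` is symmetric; stationarity in the adapters gives `S Uₜ = 0`.

Suppose `S s = r s` with `r > 0`, `s ≠ 0`. A dimension count (`exists_kernel_vector`) gives a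
nonzero triple `(y, a, c)` with `y` in the span of the adapters, `U₁a = U₂b` for `b = U₂ᵀy`, and
`W₁ᵀ(y + cs) = 0`. Evaluating `2S` at `y + cs` yields `|U₁ᵀy| ≤ |b|`; since `|b|² = ⟨U₁ᵀy, a⟩`, also
`|b| ≤ |a|`. Because `U₁a = U₂b`, the displacements `saᵀ, sbᵀ` change both products `UₜUₜᵀ` equally
to first order, which `A` absorbs. The remaining curvature is proportional to `|b|² - |a|²`, and
lengthening `saᵀ` slightly makes it negative unless `a = 0` (`AdapterStable.eq_zero_of_le`). Then
the whole triple vanishes, a contradiction. Exchanging the tasks excludes `r < 0`, so `S = 0`.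

Conversely, at zero residuals the Hessian form is a sum of squares. -/

namespace MetaLoRA

open Matrix

/-! ### Second-order stability forces the residual to vanish. -/

section LinearAlgebra

variable {d k : ℕ}

/-- Second-order stationarity, minimised over the displacement of the shared matrix: a
displacement `V₁, V₂` of the adapters does not decrease the loss to second order. -/
def AdapterStable (S : Matrix (Fin d) (Fin d) ℝ) (U₁ U₂ : Matrix (Fin d) (Fin k) ℝ) : Prop :=
  ∀ V₁ V₂ : Matrix (Fin d) (Fin k) ℝ,
    0 ≤ 1 / 4 * trace ((U₁ * V₁ᵀ + V₁ * U₁ᵀ - (U₂ * V₂ᵀ + V₂ * U₂ᵀ))ᵀ *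
        (U₁ * V₁ᵀ + V₁ * U₁ᵀ - (U₂ * V₂ᵀ + V₂ * U₂ᵀ)))
      - trace (S * (V₁ * V₁ᵀ)) + trace (S * (V₂ * V₂ᵀ))

theorem AdapterStable.swap {S : Matrix (Fin d) (Fin d) ℝ} {U₁ U₂ : Matrix (Fin d) (Fin k) ℝ}
    (h : AdapterStable S U₁ U₂) : AdapterStable (-S) U₂ U₁ := by
  intro V₁ V₂
  have := h V₂ V₁
  rw [← neg_sub (U₂ * V₁ᵀ + V₁ * U₂ᵀ), transpose_neg, neg_mul_neg] at this
  simp only [neg_mul, trace_neg]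
  linarith

theorem AdapterStable.eq_zero_of_le {S : Matrix (Fin d) (Fin d) ℝ}
    {U₁ U₂ : Matrix (Fin d) (Fin k) ℝ} (h : AdapterStable S U₁ U₂)
    {s : Fin d → ℝ} {r : ℝ} (hs : s ≠ 0) (hSs : S *ᵥ s = r • s) (hr : 0 < r)
    {a b : Fin k → ℝ} (hab : U₁ *ᵥ a = U₂ *ᵥ b) (hle : b ⬝ᵥ b ≤ a ⬝ᵥ a) : a = 0 := by
  by_contra ha
  have ha' : 0 < a ⬝ᵥ a := by simpa using dotProduct_star_self_pos_iff.2 ha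
  have hs' : 0 < s ⬝ᵥ s := by simpa using dotProduct_star_self_pos_iff.2 hs
  -- At `ε = 0` the squared term vanishes because `U₁a = U₂b`. The factor `1 + ε` gains at first
  -- order in `ε` and costs only `ε²`, which settles the case `|a| = |b|`.
  have key (ε : ℝ) := h ((1 + ε) • vecMulVec s a) (vecMulVec s b)
  set C := vecMulVec (U₂ *ᵥ b) s + vecMulVec s (U₂ *ᵥ b) with hC
  have e (ε : ℝ) : U₁ * ((1 + ε) • vecMulVec s a)ᵀ + ((1 + ε) • vecMulVec s a) * U₁ᵀ -
      (U₂ * (vecMulVec s b)ᵀ + vecMulVec s b * U₂ᵀ) = ε • C := by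
    simp only [transpose_smul, transpose_vecMulVec, Matrix.mul_smul, Matrix.smul_mul, mul_vecMulVec,
      vecMulVec_mul, vecMul_transpose, hab, hC]
    module
  have tr (c : Fin k → ℝ) : trace (S * (vecMulVec s c * (vecMulVec s c)ᵀ)) =
      r * (s ⬝ᵥ s) * (c ⬝ᵥ c) := by
    rw [transpose_vecMulVec, vecMulVec_mul_vecMulVec, mul_vecMulVec, hSs, trace_vecMulVec,
      smul_dotProduct, dotProduct_smul, smul_eq_mul, smul_eq_mul]
    ring
  have key' (ε : ℝ) : 0 ≤ 1 / 4 * (ε ^ 2 * trace (Cᵀ * C)) -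
      (1 + ε) ^ 2 * (r * (s ⬝ᵥ s) * (a ⬝ᵥ a)) + r * (s ⬝ᵥ s) * (b ⬝ᵥ b) := by
    have := key ε
    rw [e] at this
    simp only [transpose_smul, Matrix.smul_mul, Matrix.mul_smul, trace_smul, tr,
      smul_eq_mul] at this
    linarith
  set T := trace (Cᵀ * C)
  set m := r * (s ⬝ᵥ s) * (a ⬝ᵥ a)
  have hm : 0 < m := by positivity
  have hb : r * (s ⬝ᵥ s) * (b ⬝ᵥ b) ≤ m :=
    mul_le_mul_of_nonneg_left hle (by positivity)
  -- This size of `ε` gives `ε²T ≤ εm`, so the cost `ε²T/4` is below the gain `2εm`.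
  have hε : 0 < m / (|T| + 1) := by positivity
  have h1 := key' (m / (|T| + 1))
  set ε := m / (|T| + 1) with hεd
  have h2 : ε * (|T| + 1) = m := by rw [hεd]; field_simp
  have h3 : T ≤ |T| + 1 := by linarith [le_abs_self T]
  have h4 : ε * (ε * T) ≤ ε * m := by rw [← h2]; gcongr
  nlinarith [mul_pos hε hm, mul_pos hε (mul_pos hε hm)]

theorem dotProduct_mul_transpose_mulVec {m : ℕ} (U : Matrix (Fin m) (Fin k) ℝ) (x : Fin m → ℝ) :
    x ⬝ᵥ ((U * Uᵀ) *ᵥ x) = (Uᵀ *ᵥ x) ⬝ᵥ (Uᵀ *ᵥ x) := by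
  rw [← mulVec_mulVec, dotProduct_mulVec, ← mulVec_transpose]

theorem dotProduct_self_nonneg_real {m : ℕ} (x : Fin m → ℝ) : 0 ≤ x ⬝ᵥ x := by
  simpa using dotProduct_star_self_nonneg x

/-- The sum of the column spaces of `U₁` and `U₂`. -/
def colSpan (U₁ U₂ : Matrix (Fin d) (Fin k) ℝ) : Submodule ℝ (Fin d → ℝ) :=
  LinearMap.range U₁.mulVecLin ⊔ LinearMap.range U₂.mulVecLin

theorem mulVec_left_mem_colSpan (U₁ U₂ : Matrix (Fin d) (Fin k) ℝ) (a : Fin k → ℝ) :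
    U₁ *ᵥ a ∈ colSpan U₁ U₂ :=
  Submodule.mem_sup_left ⟨a, rfl⟩

theorem mulVec_right_mem_colSpan (U₁ U₂ : Matrix (Fin d) (Fin k) ℝ) (a : Fin k → ℝ) :
    U₂ *ᵥ a ∈ colSpan U₁ U₂ :=
  Submodule.mem_sup_right ⟨a, rfl⟩

theorem mulVec_eq_zero_of_mem_colSpan {S : Matrix (Fin d) (Fin d) ℝ}
    {U₁ U₂ : Matrix (Fin d) (Fin k) ℝ} (h₁ : S * U₁ = 0) (h₂ : S * U₂ = 0)
    {y : Fin d → ℝ} (hy : y ∈ colSpan U₁ U₂) : S *ᵥ y = 0 := by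
  obtain ⟨_, ⟨a, rfl⟩, _, ⟨b, rfl⟩, rfl⟩ := Submodule.mem_sup.1 hy
  simp [mulVec_add, h₁, h₂]

theorem eq_zero_of_mem_colSpan {U₁ U₂ : Matrix (Fin d) (Fin k) ℝ}
    {y : Fin d → ℝ} (hy : y ∈ colSpan U₁ U₂) (h₁ : U₁ᵀ *ᵥ y = 0) (h₂ : U₂ᵀ *ᵥ y = 0) :
    y = 0 := by
  obtain ⟨_, ⟨a, rfl⟩, _, ⟨b, rfl⟩, hab⟩ := Submodule.mem_sup.1 hy
  rw [← dotProduct_self_eq_zero]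
  nth_rw 2 [← hab]
  simp [dotProduct_add, dotProduct_mulVec, ← mulVec_transpose, h₁, h₂]

/-- A dimension count on the span of the adapters. -/
theorem exists_kernel_vector (U₁ U₂ W : Matrix (Fin d) (Fin k) ℝ) (s : Fin d → ℝ) :
    ∃ y ∈ colSpan U₁ U₂, ∃ (a : Fin k → ℝ) (c : ℝ), (y ≠ 0 ∨ a ≠ 0 ∨ c ≠ 0) ∧
      U₁ *ᵥ a = (U₂ * U₂ᵀ) *ᵥ y ∧ Wᵀ *ᵥ (y + c • s) = 0 := by
  let E := colSpan U₁ U₂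
  let g : E × (Fin k → ℝ) × ℝ →ₗ[ℝ] E × (Fin k → ℝ) :=
    { toFun := fun p => (⟨U₂ *ᵥ (U₂ᵀ *ᵥ (p.1 : Fin d → ℝ)) - U₁ *ᵥ p.2.1,
        sub_mem (mulVec_right_mem_colSpan _ _ _) (mulVec_left_mem_colSpan _ _ _)⟩,
        Wᵀ *ᵥ ((p.1 : Fin d → ℝ) + p.2.2 • s))
      map_add' := fun p q => by
        ext i
        · simp [mulVec_add]; ring
        · simp [mulVec_add, add_smul]; abel
      map_smul' := fun c p => by
        ext i
        · simp [mulVec_smul, mul_sub]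
        · simp [mulVec_add, mulVec_smul, mul_smul] }
  have hg : LinearMap.ker g ≠ ⊥ := by
    -- The scalar `c` is the one extra dimension of the source.
    apply LinearMap.ker_ne_bot_of_finrank_lt
    simp
  obtain ⟨⟨y, a, c⟩, hp, hne⟩ := (Submodule.ne_bot_iff _).1 hg
  have hp' := LinearMap.mem_ker.1 hp
  have e1 : U₂ *ᵥ (U₂ᵀ *ᵥ (y : Fin d → ℝ)) - U₁ *ᵥ a = 0 :=
    congrArg (fun q : E × (Fin k → ℝ) => (q.1 : Fin d → ℝ)) hp'
  have e2 : Wᵀ *ᵥ ((y : Fin d → ℝ) + c • s) = 0 := congrArg Prod.snd hp'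
  refine ⟨y, y.2, a, c, ?_, ?_, e2⟩
  · by_contra! hcon
    exact hne (by ext1; exacts [Subtype.ext hcon.1, Prod.ext hcon.2.1 hcon.2.2])
  · rw [← mulVec_mulVec]; exact (sub_eq_zero.1 e1).symm

theorem AdapterStable.not_pos_eigenvalue {S : Matrix (Fin d) (Fin d) ℝ}
    {U₁ U₂ W₁ W₂ : Matrix (Fin d) (Fin k) ℝ} (h : AdapterStable S U₁ U₂) (hS : Sᵀ = S)
    (h2 : S + S = W₁ * W₁ᵀ - U₁ * U₁ᵀ - (W₂ * W₂ᵀ - U₂ * U₂ᵀ))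
    (h₁ : S * U₁ = 0) (h₂ : S * U₂ = 0) {s : Fin d → ℝ} {r : ℝ} (hs : s ≠ 0)
    (hSs : S *ᵥ s = r • s) : r ≤ 0 := by
  by_contra! hr
  have hs' : 0 < s ⬝ᵥ s := by simpa using dotProduct_star_self_pos_iff.2 hs
  have perp {U : Matrix (Fin d) (Fin k) ℝ} (hU : S * U = 0) : Uᵀ *ᵥ s = 0 := by
    have h3 : Uᵀ *ᵥ (S *ᵥ s) = 0 := by
      rw [mulVec_mulVec, ← hS, ← transpose_mul, hU]; simp
    rw [hSs, mulVec_smul] at h3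
    exact (smul_eq_zero.1 h3).resolve_left hr.ne'
  obtain ⟨y, hy, a, c, hne, hKKT, hW⟩ := exists_kernel_vector U₁ U₂ W₁ s
  have hSy := mulVec_eq_zero_of_mem_colSpan h₁ h₂ hy
  have form := congrArg (fun B => (y + c • s) ⬝ᵥ (B *ᵥ (y + c • s))) h2
  have u₁ : U₁ᵀ *ᵥ (y + c • s) = U₁ᵀ *ᵥ y := by simp [mulVec_add, mulVec_smul, perp h₁]
  have u₂ : U₂ᵀ *ᵥ (y + c • s) = U₂ᵀ *ᵥ y := by simp [mulVec_add, mulVec_smul, perp h₂]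
  have hsy : y ⬝ᵥ s = 0 := by
    have h3 : y ⬝ᵥ (S *ᵥ s) = 0 := by
      rw [dotProduct_mulVec, ← mulVec_transpose, hS, hSy, zero_dotProduct]
    rw [hSs, dotProduct_smul, smul_eq_mul] at h3
    exact (mul_eq_zero.1 h3).resolve_left hr.ne'
  have hq : (y + c • s) ⬝ᵥ (S *ᵥ (y + c • s)) = r * c ^ 2 * (s ⬝ᵥ s) := by
    rw [mulVec_add, hSy, zero_add, mulVec_smul, hSs, add_dotProduct]
    simp only [dotProduct_smul, smul_dotProduct, smul_eq_mul, hsy]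
    ring
  simp only [sub_mulVec, add_mulVec, dotProduct_add _ (S *ᵥ _), dotProduct_sub,
    dotProduct_mul_transpose_mulVec, u₁, u₂, hW, hq, zero_dotProduct] at form
  have hb2 : (U₂ᵀ *ᵥ y) ⬝ᵥ (U₂ᵀ *ᵥ y) = (U₁ᵀ *ᵥ y) ⬝ᵥ a := by
    rw [← dotProduct_mul_transpose_mulVec, ← hKKT, dotProduct_mulVec, ← mulVec_transpose]
  have hW2 := dotProduct_self_nonneg_real (W₂ᵀ *ᵥ (y + c • s))
  have hp := dotProduct_self_nonneg_real (U₁ᵀ *ᵥ y)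
  have hc0 : 0 ≤ r * c ^ 2 * (s ⬝ᵥ s) := by positivity
  -- With `p = U₁ᵀy`, this reads `2|b|² ≤ |p|² + |a|²`; as `|p| ≤ |b|` by `form`, it follows that
  -- `|b| ≤ |a|`.
  have hsq := dotProduct_self_nonneg_real (U₁ᵀ *ᵥ y - a)
  rw [dotProduct_sub, sub_dotProduct, sub_dotProduct, dotProduct_comm a] at hsq
  have ha : a = 0 := by
    apply h.eq_zero_of_le hs hSs hr (b := U₂ᵀ *ᵥ y)
    · rw [hKKT, mulVec_mulVec]
    · linarith
  subst ha
  have z₂ : U₂ᵀ *ᵥ y = 0 := by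
    rw [← dotProduct_self_eq_zero, hb2, dotProduct_zero]
  simp only [z₂, dotProduct_zero] at form hb2
  have z₁ : U₁ᵀ *ᵥ y = 0 := by
    rw [← dotProduct_self_eq_zero]; linarith
  have hc : c = 0 := by
    by_contra hc
    have : 0 < r * c ^ 2 * (s ⬝ᵥ s) := by positivity
    linarith
  have := eq_zero_of_mem_colSpan hy z₁ z₂
  tauto

theorem AdapterStable.eq_zero {S : Matrix (Fin d) (Fin d) ℝ}
    {U₁ U₂ W₁ W₂ : Matrix (Fin d) (Fin k) ℝ} (h : AdapterStable S U₁ U₂) (hS : Sᵀ = S)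
    (h2 : S + S = W₁ * W₁ᵀ - U₁ * U₁ᵀ - (W₂ * W₂ᵀ - U₂ * U₂ᵀ))
    (h₁ : S * U₁ = 0) (h₂ : S * U₂ = 0) : S = 0 := by
  by_contra hne
  have hH : S.IsHermitian := by rw [IsHermitian, conjTranspose_eq_transpose_of_trivial, hS]
  obtain ⟨v, r, hr, hv, hSv⟩ := hH.exists_eigenvector_of_ne_zero hne
  have le1 := h.not_pos_eigenvalue hS h2 h₁ h₂ hv hSv
  have le2 : -r ≤ 0 := by
    apply h.swap.not_pos_eigenvalue (W₁ := W₂) (W₂ := W₁) (s := v) <;>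
      simp_all [neg_mulVec]
    rw [← neg_add, h2]; abel
  exact hr (by linarith)

end LinearAlgebra

/-! ### Gradient and Hessian of a `C²` function. -/

section Calculus

variable {E : Type*} [NormedAddCommGroup E] [InnerProductSpace ℝ E] [CompleteSpace E]

theorem differentiable_gradient {f : E → ℝ} (hf : ContDiff ℝ 2 f) :
    Differentiable ℝ (gradient f) :=
  (InnerProductSpace.toDual ℝ E).symm.differentiable.comp
    ((hf.fderiv_right (m := 1) (by norm_num)).differentiable (by norm_num))

theorem inner_hessian {f : E → ℝ} (hf : ContDiff ℝ 2 f) (x v w : E) :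
    inner ℝ (hessian f x v) w = fderiv ℝ (fderiv ℝ f) x v w := by
  have hd : DifferentiableAt ℝ (fderiv ℝ f) x :=
    (hf.fderiv_right (m := 1) (by norm_num)).differentiable (by norm_num) x
  have h1 := (differentiable_gradient hf x).hasFDerivAt.inner ℝ (hasFDerivAt_const w x)
  have h2 := hd.hasFDerivAt.clm_apply (hasFDerivAt_const w x)
  have h3 : (fun y => inner ℝ (gradient f y) w) = fun y => fderiv ℝ f y w :=
    funext fun y => inner_gradient_left
  rw [h3] at h1
  simpa [hessian] using DFunLike.congr_fun (h1.unique h2) v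

theorem isSymmetric_hessian {f : E → ℝ} (hf : ContDiff ℝ 2 f) (x : E) :
    (hessian f x : E →ₗ[ℝ] E).IsSymmetric := by
  intro v w
  have hs : IsSymmSndFDerivAt ℝ f x := hf.contDiffAt.isSymmSndFDerivAt (by simp)
  rw [ContinuousLinearMap.coe_coe, real_inner_comm _ v, inner_hessian hf, inner_hessian hf, hs]

/-- The gradient and the Hessian read off from the restriction of a function to a line. -/
theorem inner_gradient_and_hessian_of_quartic {f : E → ℝ} (hf : ContDiff ℝ 2 f) {x v : E}
    {c₀ c₁ c₂ c₃ c₄ : ℝ}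
    (h : ∀ τ : ℝ, f (x + τ • v) = c₀ + c₁ * τ + c₂ * τ ^ 2 + c₃ * τ ^ 3 + c₄ * τ ^ 4) :
    inner ℝ (gradient f x) v = c₁ ∧ inner ℝ (hessian f x v) v = 2 * c₂ := by
  have line (τ : ℝ) : HasDerivAt (fun τ : ℝ => x + τ • v) v τ := by
    simpa using ((hasDerivAt_id τ).smul_const v).const_add x
  have hgrad (τ : ℝ) : inner ℝ (gradient f (x + τ • v)) v =
      c₁ + 2 * c₂ * τ + 3 * c₃ * τ ^ 2 + 4 * c₄ * τ ^ 3 := by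
    have d1 : HasDerivAt (fun τ : ℝ => f (x + τ • v)) (fderiv ℝ f (x + τ • v) v) τ :=
      ((hf.differentiable (by norm_num) _).hasFDerivAt).comp_hasDerivAt τ (line τ)
    have d2 : HasDerivAt (fun τ : ℝ => f (x + τ • v))
        (c₁ + 2 * c₂ * τ + 3 * c₃ * τ ^ 2 + 4 * c₄ * τ ^ 3) τ := by
      rw [funext h]
      have := ((((hasDerivAt_id τ).const_mul c₁).const_add c₀).add
        ((hasDerivAt_pow 2 τ).const_mul c₂)).add ((hasDerivAt_pow 3 τ).const_mul c₃) |>.add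
        ((hasDerivAt_pow 4 τ).const_mul c₄)
      refine this.congr_deriv ?_
      push_cast
      ring
    rw [inner_gradient_left]
    exact d1.unique d2
  refine ⟨by simpa using hgrad 0, ?_⟩
  have d1 : HasDerivAt (fun τ : ℝ => inner ℝ (gradient f (x + τ • v)) v)
      (inner ℝ (hessian f (x + (0 : ℝ) • v) v) v) 0 := by
    have := (((differentiable_gradient hf) _).hasFDerivAt.comp_hasDerivAt (0 : ℝ) (line 0)).inner ℝ
      (hasDerivAt_const (0 : ℝ) v)
    simpa [hessian] using this
  have d2 : HasDerivAt (fun τ : ℝ => inner ℝ (gradient f (x + τ • v)) v) (2 * c₂) 0 := by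
    rw [funext hgrad]
    have := ((((hasDerivAt_id (0 : ℝ)).const_mul (2 * c₂)).const_add c₁).add
      ((hasDerivAt_pow 2 (0 : ℝ)).const_mul (3 * c₃))).add
      ((hasDerivAt_pow 3 (0 : ℝ)).const_mul (4 * c₄))
    refine this.congr_deriv ?_
    simp
  simpa using d1.unique d2

end Calculus

theorem exists_neg_eigenvalue {E : Type*} [NormedAddCommGroup E] [InnerProductSpace ℝ E]
    [FiniteDimensional ℝ E] {T : E →ₗ[ℝ] E} (hT : T.IsSymmetric) {v : E}
    (hv : inner ℝ (T v) v < 0) : ∃ μ : ℝ, μ < 0 ∧ Module.End.HasEigenvalue T μ := by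
  by_contra! hcon
  have hn : ∀ i, 0 ≤ hT.eigenvalues rfl i := fun i => by
    by_contra! hi
    exact hcon _ hi (hT.hasEigenvalue_eigenvalues rfl i)
  refine hv.not_ge ?_
  rw [← (hT.eigenvectorBasis rfl).sum_inner_mul_inner]
  refine Finset.sum_nonneg fun i _ => ?_
  rw [hT v, hT.apply_eigenvectorBasis, inner_smul_right, real_inner_comm v, mul_assoc]
  exact mul_nonneg (hn i) (mul_self_nonneg _)

/-! ### Smoothness and directional derivatives of the loss. -/

section Loss

variable {d k : ℕ}

/-- The residual of the `t`-th retraining task. -/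
def residual {T : ℕ} (Astar : Matrix (Fin d) (Fin d) ℝ)
    (Ustar : Fin T → Matrix (Fin d) (Fin k) ℝ)
    (A : Matrix (Fin d) (Fin d) ℝ) (U : Fin T → Matrix (Fin d) (Fin k) ℝ) (t : Fin T) :
    Matrix (Fin d) (Fin d) ℝ :=
  Astar + Ustar t * (Ustar t)ᵀ - A - U t * (U t)ᵀ

theorem trace_transpose_mul_self_nonneg {m n : Type*} [Fintype m] [Fintype n]
    (B : Matrix m n ℝ) : 0 ≤ trace (Bᵀ * B) := by
  simpa using (posSemidef_conjTranspose_mul_self B).trace_nonneg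

theorem trace_transpose_mul_self_eq_zero {m n : Type*} [Fintype m] [Fintype n]
    {B : Matrix m n ℝ} : trace (Bᵀ * B) = 0 ↔ B = 0 := by
  simpa using trace_conjTranspose_mul_self_eq_zero_iff (A := B)

open scoped Matrix.Norms.Frobenius in
theorem frobenius_norm_sq_eq_trace {m n : Type*} [Fintype m] [Fintype n] (B : Matrix m n ℝ) :
    ‖B‖ ^ 2 = trace (Bᵀ * B) := by
  rw [frobenius_norm_def, ← Real.sqrt_eq_rpow, Real.sq_sqrt (by positivity), Finset.sum_comm]
  simp [trace, mul_apply, pow_two]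

variable {T : ℕ} (Astar : Matrix (Fin d) (Fin d) ℝ) (Ustar : Fin T → Matrix (Fin d) (Fin k) ℝ)

theorem loss_eq_sum_trace (A : Matrix (Fin d) (Fin d) ℝ) (U : Fin T → Matrix (Fin d) (Fin k) ℝ) :
    loss Astar Ustar A U =
      (1 / 2) * ∑ t, trace ((residual Astar Ustar A U t)ᵀ * residual Astar Ustar A U t) := by
  simp only [loss, frobenius_norm_sq_eq_trace]
  rfl

theorem loss_nonneg (A : Matrix (Fin d) (Fin d) ℝ) (U : Fin T → Matrix (Fin d) (Fin k) ℝ) :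
    0 ≤ loss Astar Ustar A U := by
  rw [loss_eq_sum_trace]
  have := Finset.sum_nonneg fun t (_ : t ∈ Finset.univ) =>
    trace_transpose_mul_self_nonneg (residual Astar Ustar A U t)
  positivity

theorem loss_eq_zero_iff {A : Matrix (Fin d) (Fin d) ℝ} {U : Fin T → Matrix (Fin d) (Fin k) ℝ} :
    loss Astar Ustar A U = 0 ↔ ∀ t, residual Astar Ustar A U t = 0 := by
  rw [loss_eq_sum_trace, mul_eq_zero, or_iff_right (by norm_num),
    Finset.sum_eq_zero_iff_of_nonneg fun t _ => trace_transpose_mul_self_nonneg _]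
  simp [trace_transpose_mul_self_eq_zero]

theorem loss_self : loss Astar Ustar Astar Ustar = 0 := by
  rw [loss_eq_zero_iff]
  intro t
  rw [residual]; abel

theorem contDiff_flatLoss : ContDiff ℝ 2 (flatLoss Astar Ustar : Param T d k → ℝ) := by
  have : (flatLoss Astar Ustar : Param T d k → ℝ) = fun x => (1 / 2) * ∑ t, ∑ i, ∑ j,
      (Astar j i + (∑ a, Ustar t j a * Ustar t i a) - x (Sum.inl (j, i)) -
        ∑ a, x (Sum.inr (t, j, a)) * x (Sum.inr (t, i, a))) ^ 2 := by
    ext x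
    rw [flatLoss, loss_eq_sum_trace]
    simp [trace, mul_apply, residual, partA, partU, pow_two, mul_comm]
  rw [this]
  fun_prop

theorem residual_line (A D : Matrix (Fin d) (Fin d) ℝ) (U V : Fin T → Matrix (Fin d) (Fin k) ℝ)
    (τ : ℝ) (t : Fin T) :
    residual Astar Ustar (A + τ • D) (U + τ • V) t = residual Astar Ustar A U t -
      τ • (D + (U t * (V t)ᵀ + V t * (U t)ᵀ)) - τ ^ 2 • (V t * (V t)ᵀ) := by
  simp only [residual, Pi.add_apply, Pi.smul_apply, transpose_add, transpose_smul, Matrix.mul_add,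
    Matrix.add_mul, Matrix.smul_mul, Matrix.mul_smul]
  module

theorem trace_transpose_mul_comm {m n : Type*} [Fintype m] [Fintype n] (B C : Matrix m n ℝ) :
    trace (Bᵀ * C) = trace (Cᵀ * B) := by
  rw [← trace_transpose, transpose_mul, transpose_transpose]

theorem trace_quadratic_line (R B C : Matrix (Fin d) (Fin d) ℝ) (τ : ℝ) :
    trace ((R - τ • B - τ ^ 2 • C)ᵀ * (R - τ • B - τ ^ 2 • C)) =
      trace (Rᵀ * R) + -2 * trace (Rᵀ * B) * τ +
        (trace (Bᵀ * B) - 2 * trace (Rᵀ * C)) * τ ^ 2 +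
        2 * trace (Bᵀ * C) * τ ^ 3 + trace (Cᵀ * C) * τ ^ 4 := by
  simp only [transpose_sub, transpose_smul, Matrix.sub_mul, Matrix.mul_sub, Matrix.smul_mul,
    Matrix.mul_smul, trace_sub, trace_smul, smul_eq_mul]
  rw [trace_transpose_mul_comm B R, trace_transpose_mul_comm C R, trace_transpose_mul_comm C B]
  ring

/-- The directional derivative and the second directional derivative of the loss. -/
theorem inner_gradient_and_hessian_flatLoss (A D : Matrix (Fin d) (Fin d) ℝ)
    (U V : Fin T → Matrix (Fin d) (Fin k) ℝ) :
    inner ℝ (gradient (flatLoss Astar Ustar) (flatten A U)) (flatten D V) =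
      -∑ t, trace ((residual Astar Ustar A U t)ᵀ * (D + (U t * (V t)ᵀ + V t * (U t)ᵀ))) ∧
    inner ℝ (hessian (flatLoss Astar Ustar) (flatten A U) (flatten D V)) (flatten D V) =
      ∑ t, (trace ((D + (U t * (V t)ᵀ + V t * (U t)ᵀ))ᵀ * (D + (U t * (V t)ᵀ + V t * (U t)ᵀ))) -
        2 * trace ((residual Astar Ustar A U t)ᵀ * (V t * (V t)ᵀ))) := by
  set R := residual Astar Ustar A U with hR
  set B : Fin T → Matrix (Fin d) (Fin d) ℝ := fun t => D + (U t * (V t)ᵀ + V t * (U t)ᵀ) with hB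
  have h := inner_gradient_and_hessian_of_quartic (contDiff_flatLoss Astar Ustar)
    (x := flatten A U) (v := flatten D V)
    (c₀ := (1 / 2) * ∑ t, trace ((R t)ᵀ * R t))
    (c₁ := (1 / 2) * ∑ t, -2 * trace ((R t)ᵀ * B t))
    (c₂ := (1 / 2) * ∑ t, (trace ((B t)ᵀ * B t) - 2 * trace ((R t)ᵀ * (V t * (V t)ᵀ))))
    (c₃ := (1 / 2) * ∑ t, 2 * trace ((B t)ᵀ * (V t * (V t)ᵀ)))
    (c₄ := (1 / 2) * ∑ t, trace ((V t * (V t)ᵀ)ᵀ * (V t * (V t)ᵀ))) (fun τ => by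
      have e : flatten A U + τ • flatten D V = flatten (A + τ • D) (U + τ • V) := by
        ext i; rcases i with i | i <;> rfl
      rw [e, flatLoss, partA_flatten, partU_flatten, loss_eq_sum_trace]
      simp only [residual_line, trace_quadratic_line, Finset.sum_add_distrib, ← Finset.sum_mul]
      ring)
  rw [← Finset.mul_sum] at h
  exact ⟨by rw [h.1]; ring, by rw [h.2]; ring⟩

end Loss

/-! ### Critical points for two tasks. -/

section TwoTasks

variable {d k : ℕ} {Astar : Matrix (Fin d) (Fin d) ℝ} {Ustar : Fin 2 → Matrix (Fin d) (Fin k) ℝ}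
  {A : Matrix (Fin d) (Fin d) ℝ} {U : Fin 2 → Matrix (Fin d) (Fin k) ℝ}

theorem residual_of_gradient_eq_zero
    (h : gradient (flatLoss Astar Ustar) (flatten A U) = 0) :
    residual Astar Ustar A U 1 = -residual Astar Ustar A U 0 ∧
      (residual Astar Ustar A U 0)ᵀ = residual Astar Ustar A U 0 ∧
      ∀ t, residual Astar Ustar A U 0 * U t = 0 := by
  have crit (D : Matrix (Fin d) (Fin d) ℝ) (V : Fin 2 → Matrix (Fin d) (Fin k) ℝ) := by
    have := (inner_gradient_and_hessian_flatLoss Astar Ustar A D U V).1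
    rw [h, inner_zero_left, Fin.sum_univ_two] at this
    exact this
  set R := residual Astar Ustar A U with hR
  have hneg : R 1 = -R 0 := by
    have h1 := crit (R 0 + R 1) 0
    simp only [Pi.zero_apply, transpose_zero, Matrix.mul_zero, Matrix.zero_mul, add_zero,
      ← trace_add, ← Matrix.add_mul, ← transpose_add] at h1
    have := trace_transpose_mul_self_eq_zero.1 (neg_eq_zero.1 h1.symm)
    exact (neg_eq_of_add_eq_zero_right this).symm
  have hdiff : R 0 - R 1 = Ustar 0 * (Ustar 0)ᵀ - U 0 * (U 0)ᵀ -
      (Ustar 1 * (Ustar 1)ᵀ - U 1 * (U 1)ᵀ) := by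
    simp only [hR, residual]; abel
  have hsymm : (R 0)ᵀ = R 0 := by
    -- The possibly asymmetric `Astar - A` cancels in `R 0 - R 1`.
    have h2 : (2 : ℝ) • R 0 = R 0 - R 1 := by rw [hneg]; module
    have h3 : R 0 = (1 / 2 : ℝ) • (R 0 - R 1) := by rw [← h2]; module
    rw [h3, hdiff]
    simp [transpose_mul]
  refine ⟨hneg, hsymm, fun t => ?_⟩
  have key : trace ((R t)ᵀ * (U t * (R 0 * U t)ᵀ + R 0 * U t * (U t)ᵀ)) = 0 := by
    -- Along `R 0 * U t` the first variation is, up to sign, `2|R 0 * U t|²`.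
    have h1 := crit 0 (Pi.single t (R 0 * U t))
    fin_cases t <;> simpa using h1
  have hquad : trace (R 0 * (U t * (R 0 * U t)ᵀ + R 0 * U t * (U t)ᵀ)) = 0 := by
    fin_cases t
    · simpa [hsymm] using key
    · simpa [hneg, hsymm] using key
  rw [← trace_transpose_mul_self_eq_zero]
  have e1 : trace (R 0 * (U t * (R 0 * U t)ᵀ)) = trace ((R 0 * U t)ᵀ * (R 0 * U t)) := by
    rw [← Matrix.mul_assoc, trace_mul_comm]
  have e2 : trace (R 0 * (R 0 * U t * (U t)ᵀ)) = trace ((R 0 * U t)ᵀ * (R 0 * U t)) := by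
    rw [← Matrix.mul_assoc, trace_mul_comm, transpose_mul, hsymm, Matrix.mul_assoc]
  rw [Matrix.mul_add, trace_add, e1, e2] at hquad
  linarith

/-- A critical point at which the Hessian has no descent direction has zero loss. -/
theorem loss_eq_zero_of_secondOrder
    (hg : gradient (flatLoss Astar Ustar) (flatten A U) = 0)
    (hH : ∀ v, 0 ≤ inner ℝ (hessian (flatLoss Astar Ustar) (flatten A U) v) v) :
    loss Astar Ustar A U = 0 := by
  obtain ⟨hneg, hsymm, hU⟩ := residual_of_gradient_eq_zero hg
  have hdiff : residual Astar Ustar A U 0 - residual Astar Ustar A U 1 =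
      Ustar 0 * (Ustar 0)ᵀ - U 0 * (U 0)ᵀ - (Ustar 1 * (Ustar 1)ᵀ - U 1 * (U 1)ᵀ) := by
    simp only [residual]; abel
  have hst : AdapterStable (residual Astar Ustar A U 0) (U 0) (U 1) := by
    intro V₁ V₂
    set W₁ := U 0 * V₁ᵀ + V₁ * (U 0)ᵀ with hW₁
    set W₂ := U 1 * V₂ᵀ + V₂ * (U 1)ᵀ with hW₂
    -- This displacement of `A` minimises `|D + W₁|² + |D + W₂|²`, with value `|W₁ - W₂|²/2`.
    have h1 := hH (flatten (-(1 / 2 : ℝ) • (W₁ + W₂)) ![V₁, V₂])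
    rw [(inner_gradient_and_hessian_flatLoss Astar Ustar A _ U _).2, Fin.sum_univ_two] at h1
    simp only [Matrix.cons_val_zero, Matrix.cons_val_one, ← hW₁, ← hW₂] at h1
    have e1 : -(1 / 2 : ℝ) • (W₁ + W₂) + W₁ = (1 / 2 : ℝ) • (W₁ - W₂) := by module
    have e2 : -(1 / 2 : ℝ) • (W₁ + W₂) + W₂ = -(1 / 2 : ℝ) • (W₁ - W₂) := by module
    rw [e1, e2, hneg, transpose_neg, hsymm] at h1
    simp only [transpose_smul, Matrix.smul_mul, Matrix.mul_smul, trace_smul, smul_eq_mul,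
      Matrix.neg_mul, trace_neg] at h1
    linarith
  have hzero : residual Astar Ustar A U 0 = 0 :=
    hst.eq_zero (W₁ := Ustar 0) (W₂ := Ustar 1) hsymm
      (by rw [← hdiff, hneg, sub_neg_eq_add]) (hU 0) (hU 1)
  rw [loss_eq_zero_iff]
  exact Fin.forall_fin_two.2 ⟨hzero, by rw [hneg, hzero, neg_zero]⟩

theorem isSOSP_of_loss_eq_zero {T : ℕ} {Ustar U : Fin T → Matrix (Fin d) (Fin k) ℝ}
    (h : loss Astar Ustar A U = 0) : IsSOSP (flatLoss Astar Ustar) (flatten A U) := by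
  have hR := (loss_eq_zero_iff Astar Ustar).1 h
  refine ⟨ext_inner_right ℝ fun v => ?_, ?_⟩
  · rw [← flatten_parts v, (inner_gradient_and_hessian_flatLoss Astar Ustar A _ U _).1]
    simp [hR]
  · refine (ContinuousLinearMap.isPositive_def').2 ⟨?_, fun v => ?_⟩
    · exact (isSymmetric_hessian (contDiff_flatLoss Astar Ustar) _).isSelfAdjoint
    · rw [ContinuousLinearMap.reApplyInnerSelf_apply, ← flatten_parts v,
        (inner_gradient_and_hessian_flatLoss Astar Ustar A _ U _).2]
      simp only [hR, transpose_zero, Matrix.zero_mul, trace_zero, mul_zero, sub_zero,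
        RCLike.re_to_real]
      exact Finset.sum_nonneg fun t _ =>
        trace_transpose_mul_self_nonneg (m := Fin d) (n := Fin d) _

theorem loss_eq_zero_iff_isSOSP :
    loss Astar Ustar A U = 0 ↔ IsSOSP (flatLoss Astar Ustar) (flatten A U) :=
  ⟨isSOSP_of_loss_eq_zero, fun h => loss_eq_zero_of_secondOrder h.1 h.2.inner_nonneg_left⟩

end TwoTasks

end MetaLoRA

theorem theorem4 (d k : ℕ) (Astar : Matrix (Fin d) (Fin d) ℝ)
    (Ustar : Fin 2 → Matrix (Fin d) (Fin k) ℝ)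
    (hUstar : LinearIndependent ℝ (fun p : Fin 2 × Fin k => (Ustar p.1).col p.2))
    (A : Matrix (Fin d) (Fin d) ℝ) (U : Fin 2 → Matrix (Fin d) (Fin k) ℝ) :
    -- zero loss is the same as second-order stationarity
    (MetaLoRA.loss Astar Ustar A U = 0 ↔
      MetaLoRA.IsSOSP (MetaLoRA.flatLoss Astar Ustar) (MetaLoRA.flatten A U)) ∧
    -- the global minimizers are the second-order stationary points
    ((∀ (A' : Matrix (Fin d) (Fin d) ℝ) (U' : Fin 2 → Matrix (Fin d) (Fin k) ℝ),
        MetaLoRA.loss Astar Ustar A U ≤ MetaLoRA.loss Astar Ustar A' U') ↔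
      MetaLoRA.IsSOSP (MetaLoRA.flatLoss Astar Ustar) (MetaLoRA.flatten A U)) ∧
    -- at a critical point with nonzero loss the Hessian has a negative eigenvalue
    (gradient (MetaLoRA.flatLoss Astar Ustar) (MetaLoRA.flatten A U) = 0 →
      MetaLoRA.loss Astar Ustar A U ≠ 0 →
      ∃ μ : ℝ, μ < 0 ∧ Module.End.HasEigenvalue
        (MetaLoRA.hessian (MetaLoRA.flatLoss Astar Ustar) (MetaLoRA.flatten A U) :
          MetaLoRA.Param 2 d k →ₗ[ℝ] MetaLoRA.Param 2 d k) μ) := by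
  refine ⟨MetaLoRA.loss_eq_zero_iff_isSOSP, ?_, fun hg hne => ?_⟩
  · rw [← MetaLoRA.loss_eq_zero_iff_isSOSP]
    refine ⟨fun h => ?_, fun h A' U' => h.trans_le (MetaLoRA.loss_nonneg _ _ _ _)⟩
    exact le_antisymm ((h Astar Ustar).trans_eq (MetaLoRA.loss_self _ _))
      (MetaLoRA.loss_nonneg _ _ _ _)
  · by_contra hcon
    refine hne (MetaLoRA.loss_eq_zero_of_secondOrder hg fun v => ?_)
    by_contra! hv
    exact hcon (MetaLoRA.exists_neg_eigenvalue
      (MetaLoRA.isSymmetric_hessian (MetaLoRA.contDiff_flatLoss Astar Ustar) _) hv)
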